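/- Let $\mu$ be a Borel probability measure on the unit circle $\mathbb T$ with infinite support, and let $\langle f,g\rangle_\mu=\int_{\mathbb T} f\,\overline g\,d\mu$. Let $\rho_k$ ($k\ge 0$) be the monic Szegő polynomials of $\mu$ (monic of degree $k$, orthogonal to $1,z,\dots,z^{k-1}$), $e_k=\langle\rho_k,\rho_k\rangle_\mu$, $\varphi_k=\rho_k/\sqrt{e_k}$, $\rho_k^*(z)=z^k\,\overline{\rho_k(1/\overline z)}$, and let $\delta_k=\rho_k(0)$ be the Schur parameters (so $\delta_0=1$) and $\eta_k=\sqrt{1-|\delta_k|^2}$ for $k\ge1$. Let $\mathcal H(\delta)=(h_{i,j})_{i,j\ge0}$ be the Hessenberg matrix with $$h_{i,j}=-\overline{\delta_j}\,\delta_{i+1}\prod_{k=j+1}^{i}\eta_k\ (j\le i),\qquad h_{i,i+1}=\eta_{i+1},\qquad h_{i,j}=0\ (j>i+1);$$ it represents multiplication by $z$ in the Szegő orthonormal basis: $z\varphi_i=\sum_{j=0}^{i+1}h_{i,j}\varphi_j$ for all $i\ge0$. Let $n\ge1$ and $u\in\mathbb T$, and let $U_n=\mathcal H_n(\delta_0,\dots,\delta_{n-1},u)$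 be the principal $n\times n$ submatrix of $\mathcal H(\delta)$ in which $\delta_n$ is replaced by $u$. Then $U_n=(d_{i,j})_{i,j=1}^n$ is a unitary matrix, with $d_{n,j}=-\overline{\delta_{j-1}}\,u\sqrt{e_{n-1}/e_{j-1}}$ for all $j$ and, for $i\le n-1$, $d_{i,j}=-\overline{\delta_{j-1}}\,\delta_i\sqrt{e_{i-1}/e_{j-1}}$ if $j\le i$, $d_{i,i+1}=\eta_i$, and $d_{i,j}=0$ if $j>i+1$. An $n$-point Szegő quadrature formula for $\mu$ with parameter $u$ is a sum $I_n(f)=\sum_{j=1}^n\lambda_jf(z_j)$ with $\lambda_j\in\mathbb R$, whose nodes $z_1,\dots,z_n$ are distinct points of $\mathbb T$ that are zeros of $P_n(z,u)=z\rho_{n-1}(z)+u\rho_{n-1}^*(z)$, and which satisfies $I_n(L)=\int_{\mathbb T}L\,d\mu$ for every Laurent polynomial $L\in\operatorname{span}\{z^k:-(n-1)\le k\le n-1\}$. Such a formula with all $\lambda_j>0$ exists, and for every such formula: 1. the eigenvalues of $U_n$ are exactly the nodes $z_1,\dots,z_n$, and these are exactly the zeros of $P_n(\cdot,u)$; 2.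 for every $j$ and every eigenvector $v=(v_0,\dots,v_{n-1})^T$ of $U_n$ for the eigenvalue $z_j$ with Euclidean norm $1$, $\lambda_j=|v_0|^2$. -/

import Mathlib

open MeasureTheory Polynomial
open scoped ComplexConjugate LaurentPolynomial

noncomputable section

namespace Szego

/-- The Borel σ-algebra of the unit circle. -/
instance : MeasurableSpace Circle := borel Circle

instance : BorelSpace Circle := ⟨rfl⟩

/-- The inner product `⟨p, q⟩_μ = ∫ p(z) conj (q(z)) dμ(z)` over the unit circle. -/
def ip (μ : Measure Circle) (p q : ℂ[X]) : ℂ :=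
  ∫ z : Circle, p.eval (z : ℂ) * conj (q.eval (z : ℂ)) ∂μ

/-- The monic Szegő polynomials `ρ_n`: the Gram–Schmidt process applied to `1, z, z², …`. -/
def rho (μ : Measure Circle) (n : ℕ) : ℂ[X] :=
  X ^ n - ∑ k : Fin n, C (ip μ (X ^ n) (rho μ k) / ip μ (rho μ k) (rho μ k)) * rho μ k
termination_by n
decreasing_by exact k.2

/-- The reversed polynomial `p*(z) = z^n conj (p(1 / conj z))` of a polynomial `p` of degree at
most `n`: its `i`-th coefficient is the conjugate of the `(n - i)`-th coefficient of `p`. -/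
def reversed (n : ℕ) (p : ℂ[X]) : ℂ[X] := (p.map (starRingEnd ℂ)).reflect n

/-- The squared norm `e_n = ⟨ρ_n, ρ_n⟩_μ`. -/
def e (μ : Measure Circle) (n : ℕ) : ℝ := (ip μ (rho μ n) (rho μ n)).re

/-- The orthonormal Szegő polynomials `φ_n = ρ_n / √e_n`. -/
def phi (μ : Measure Circle) (n : ℕ) : ℂ[X] := C (((√(e μ n))⁻¹ : ℝ) : ℂ) * rho μ n

/-- The Schur parameters `δ_n = ρ_n(0)` (so `δ_0 = 1`). -/
def schur (μ : Measure Circle) (n : ℕ) : ℂ := (rho μ n).eval 0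

/-- `η_n = √(1 - |δ_n|²)`. -/
def eta (δ : ℕ → ℂ) (n : ℕ) : ℝ := √(1 - ‖δ n‖ ^ 2)

/-- The infinite Hessenberg matrix `H(δ)` attached to a sequence of parameters, with rows and
columns numbered from `0`. -/
def hessenberg (δ : ℕ → ℂ) : Matrix ℕ ℕ ℂ :=
  Matrix.of fun i j =>
    if j ≤ i then -(conj (δ j)) * δ (i + 1) * ∏ k ∈ Finset.Ioc j i, (eta δ k : ℂ)
    else if j = i + 1 then (eta δ (i + 1) : ℂ)
    else 0

/-- `U_n = H_n(δ_0, …, δ_{n-1}, u)`: the principal submatrix of order `n` of `H(δ)`, in which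
`δ_n` is replaced by `u`. -/
def U (μ : Measure Circle) (n : ℕ) (u : Circle) : Matrix (Fin n) (Fin n) ℂ :=
  (hessenberg (Function.update (schur μ) n (u : ℂ))).submatrix Fin.val Fin.val

/-- The para-orthogonal polynomial `P_n(z, u) = z ρ_{n-1}(z) + u ρ*_{n-1}(z)`, for `n ≥ 1`. -/
def para (μ : Measure Circle) (n : ℕ) (u : Circle) : ℂ[X] :=
  X * rho μ (n - 1) + C (u : ℂ) * reversed (n - 1) (rho μ (n - 1))

/-- The space `Λ_{a,b}` spanned by `z^a, …, z^b`. -/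
def laurentSpan (a b : ℤ) : Submodule ℂ ℂ[T;T⁻¹] :=
  Submodule.span ℂ ((fun k : ℤ => (LaurentPolynomial.T k : ℂ[T;T⁻¹])) '' Set.Icc a b)

/-- The value of a Laurent polynomial at a point of the unit circle. -/
def evalCircle (L : ℂ[T;T⁻¹]) (z : Circle) : ℂ :=
  LaurentPolynomial.eval₂ (RingHom.id ℂ) (Circle.toUnits z) L

/-- `∑ j, w j * f (z j)` is the `n`-point Szegő quadrature formula for `μ` with parameter `u`:
its nodes are `n` distinct points of the unit circle which are zeros of `P_n(·, u)`, and it is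
exact on `Λ_{-(n-1), n-1}`. -/
structure IsSzegoQuadrature (μ : Measure Circle) (n : ℕ) (u : Circle)
    (z : Fin n → Circle) (w : Fin n → ℝ) : Prop where
  distinct : Function.Injective z
  isRoot : ∀ j, (para μ n u).IsRoot (z j : ℂ)
  exact : ∀ L ∈ laurentSpan (-((n : ℤ) - 1)) ((n : ℤ) - 1),
    ∑ j, (w j : ℂ) * evalCircle L (z j) = ∫ x, evalCircle L x ∂μ

end Szego

end

noncomputable section

namespace Szego

/-! ### The inner product of `μ` on polynomials -/

section InnerProduct

variable (μ : Measure Circle)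

/-! Put Φ(x) = (φ_0(x), …, φ_{n-1}(x)). Replacing δ_n by u alters only the last row of the truncated
multiplication matrix, and U_n Φ(x) = x Φ(x) outside the last coordinate, where the defect is
P_n(x,u)/√e_{n-1} (`U_mulVec_phiVec_apply`). Hence Φ(x) is an eigenvector when P_n(x,u) = 0.
Conversely, the superdiagonal entries η_k are nonzero, so an eigenvector is fixed by its first entry
and is a multiple of Φ(x) (`eq_smul_phiVec`).

The rows of U_n are the coordinates of zφ_0, …, zφ_{n-2} and -uφ*_{n-1}, which are orthonormal in
L²(μ); so U_n is unitary (`U_mem_unitaryGroup`), the zeros of P_n are unimodular, and the vectors Φ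
at distinct zeros are orthogonal. Orthogonality of P_n to z, …, z^{n-1} excludes double zeros
(`nodup_roots_para`).

Let V have columns Φ(z_j) and let D be the diagonal matrix of weights. Exactness amounts to V D V* =
1 (`exact_iff_matrix`), equivalently D V* V = 1: the Φ(z_j) are orthogonal and λ_j‖Φ(z_j)‖² = 1.
This gives existence and the value of the weights. A unit eigenvector is v_0 Φ(z_j), so
|v_0|²‖Φ(z_j)‖² = 1 as well, and λ_j = |v_0|². -/

theorem continuous_eval_circle (p : ℂ[X]) : Continuous fun z : Circle => p.eval (z : ℂ) :=
  p.continuous.comp continuous_subtype_val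

theorem circle_mul_conj (z : Circle) : (z : ℂ) * conj (z : ℂ) = 1 := by
  rw [← Circle.coe_inv_eq_conj, ← Circle.coe_mul, mul_inv_cancel, Circle.coe_one]

theorem conj_ip (p q : ℂ[X]) : conj (ip μ p q) = ip μ q p := by
  rw [ip, ip, ← integral_conj]
  congr 1
  ext z
  simp [mul_comm]

theorem ip_eq_zero_comm {p q : ℂ[X]} : ip μ p q = 0 ↔ ip μ q p = 0 := by
  rw [← conj_ip, map_eq_zero]

theorem ip_X_mul (p q : ℂ[X]) : ip μ (X * p) (X * q) = ip μ p q := by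
  rw [ip, ip]
  congr 1
  ext z
  simp only [eval_mul, eval_X, map_mul]
  linear_combination (p.eval (z : ℂ) * conj (q.eval (z : ℂ))) * circle_mul_conj z

theorem ip_self (p : ℂ[X]) :
    ip μ p p = ((∫ z : Circle, ‖p.eval (z : ℂ)‖ ^ 2 ∂μ : ℝ) : ℂ) := by
  rw [ip, ← integral_complex_ofReal]
  congr 1
  ext z
  rw [Complex.mul_conj, Complex.normSq_eq_norm_sq]

variable [IsProbabilityMeasure μ]

theorem integrable_of_continuous {f : Circle → ℂ} (hf : Continuous f) : Integrable f μ :=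
  hf.integrable_of_hasCompactSupport (HasCompactSupport.of_compactSpace f)

theorem integrable_ip (p q : ℂ[X]) :
    Integrable (fun z : Circle => p.eval (z : ℂ) * conj (q.eval (z : ℂ))) μ :=
  integrable_of_continuous μ
    ((continuous_eval_circle p).mul (Complex.continuous_conj.comp (continuous_eval_circle q)))

/-- The inner product as a linear map in its first argument. -/
def ipLin (q : ℂ[X]) : ℂ[X] →ₗ[ℂ] ℂ where
  toFun p := ip μ p q
  map_add' p p' := by
    simp only [ip, eval_add, add_mul]
    exact integral_add (integrable_ip μ p q) (integrable_ip μ p' q)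
  map_smul' c p := by
    simp only [ip, eval_smul, smul_eq_mul, mul_assoc, integral_const_mul, RingHom.id_apply]

theorem ipLin_apply (p q : ℂ[X]) : ipLin μ q p = ip μ p q := rfl

theorem ip_add_left (p p' q : ℂ[X]) : ip μ (p + p') q = ip μ p q + ip μ p' q :=
  (ipLin μ q).map_add p p'

theorem ip_sub_left (p p' q : ℂ[X]) : ip μ (p - p') q = ip μ p q - ip μ p' q :=
  (ipLin μ q).map_sub p p'

theorem ip_C_mul_left (c : ℂ) (p q : ℂ[X]) : ip μ (C c * p) q = c * ip μ p q := by
  rw [C_mul']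
  exact (ipLin μ q).map_smul c p

theorem ip_sum_left {ι : Type*} (s : Finset ι) (f : ι → ℂ[X]) (q : ℂ[X]) :
    ip μ (∑ i ∈ s, f i) q = ∑ i ∈ s, ip μ (f i) q :=
  map_sum (ipLin μ q) f s

theorem ip_C_mul_right (c : ℂ) (p q : ℂ[X]) : ip μ p (C c * q) = conj c * ip μ p q := by
  rw [← conj_ip, ip_C_mul_left, map_mul, conj_ip]

theorem ip_sum_right {ι : Type*} (s : Finset ι) (f : ι → ℂ[X]) (p : ℂ[X]) :
    ip μ p (∑ i ∈ s, f i) = ∑ i ∈ s, ip μ p (f i) := by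
  rw [← conj_ip, ip_sum_left, map_sum]
  exact Finset.sum_congr rfl fun i _ => conj_ip μ _ _

variable {μ}

/-- The finitely many zeros of `p` cannot exhaust the support; near a support point that is not a
zero, `p` is nonzero on an open set of positive measure. -/
theorem integral_norm_sq_pos (hμ : μ.support.Infinite) {p : ℂ[X]} (hp : p ≠ 0) :
    0 < ∫ z : Circle, ‖p.eval (z : ℂ)‖ ^ 2 ∂μ := by
  have hc : Continuous fun z : Circle => ‖p.eval (z : ℂ)‖ ^ 2 :=
    (continuous_eval_circle p).norm.pow 2
  rw [integral_pos_iff_support_of_nonneg (fun z => by positivity)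
    (hc.integrable_of_hasCompactSupport (HasCompactSupport.of_compactSpace _))]
  obtain ⟨z, hz, hpz⟩ : ∃ z ∈ μ.support, p.eval (z : ℂ) ≠ 0 := by
    by_contra! h
    refine hμ (Set.Finite.of_finite_image ((p.rootSet_finite ℂ).subset ?_)
      (Subtype.val_injective.injOn (s := μ.support)))
    rintro _ ⟨z, hz, rfl⟩
    rw [mem_rootSet]
    exact ⟨hp, by simpa using h z hz⟩
  refine (Measure.mem_support_iff_forall z).1 hz _ (hc.isOpen_support.mem_nhds ?_)
  simpa using hpz

theorem ip_self_ne_zero (hμ : μ.support.Infinite) {p : ℂ[X]} (hp : p ≠ 0) : ip μ p p ≠ 0 := by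
  rw [ip_self]
  exact_mod_cast (integral_norm_sq_pos hμ hp).ne'

end InnerProduct

/-! ### Reversed polynomials -/

section Reversed

theorem coeff_reversed (n : ℕ) (p : ℂ[X]) (i : ℕ) :
    (reversed n p).coeff i = conj (p.coeff (revAt n i)) := by
  rw [reversed, coeff_reflect, coeff_map]

theorem natDegree_reversed_le {n : ℕ} {p : ℂ[X]} (hp : p.natDegree ≤ n) :
    (reversed n p).natDegree ≤ n := by
  rw [natDegree_le_iff_coeff_eq_zero]
  intro i hi
  rw [coeff_reversed, revAt_eq_self_of_lt hi, coeff_eq_zero_of_natDegree_lt (hp.trans_lt hi),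
    map_zero]

theorem degree_reversed_lt {n : ℕ} {p : ℂ[X]} (hp : p.natDegree ≤ n) (h0 : p.coeff 0 = 0) :
    (reversed n p).degree < n := by
  rw [degree_lt_iff_coeff_zero]
  intro i hi
  rcases hi.lt_or_eq with hi | rfl
  · rw [coeff_reversed, revAt_eq_self_of_lt hi, coeff_eq_zero_of_natDegree_lt (hp.trans_lt hi),
      map_zero]
  · rw [coeff_reversed, revAt_le le_rfl, Nat.sub_self, h0, map_zero]

theorem eval_reversed {n : ℕ} {p : ℂ[X]} (hp : p.natDegree ≤ n) (z : Circle) :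
    (reversed n p).eval (z : ℂ) = (z : ℂ) ^ n * conj (p.eval (z : ℂ)) := by
  let _ : Invertible (conj (z : ℂ)) := ⟨z, circle_mul_conj z, by rw [mul_comm, circle_mul_conj z]⟩
  have h := eval₂_reflect_mul_pow (RingHom.id ℂ) (conj (z : ℂ)) n (p.map (starRingEnd ℂ))
    ((natDegree_map_le).trans hp)
  rw [eval₂_id, eval₂_id] at h
  change (reversed n p).eval (z : ℂ) * _ = _ at h
  rw [eval_map_apply] at h
  rw [← h, mul_left_comm, ← mul_pow, circle_mul_conj, one_pow, mul_one]

theorem reversed_add (n : ℕ) (p q : ℂ[X]) : reversed n (p + q) = reversed n p + reversed n q := by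
  rw [reversed, Polynomial.map_add, reflect_add, reversed, reversed]

theorem reversed_C_mul (n : ℕ) (c : ℂ) (p : ℂ[X]) :
    reversed n (C c * p) = C (conj c) * reversed n p := by
  rw [reversed, Polynomial.map_mul, map_C, reflect_C_mul, reversed]

theorem reversed_succ_X_mul {n : ℕ} {p : ℂ[X]} (hp : p.natDegree ≤ n) :
    reversed (n + 1) (X * p) = reversed n p := by
  rw [reversed, Polynomial.map_mul, map_X, add_comm n 1,
    reflect_mul _ _ natDegree_X_le (natDegree_map_le.trans hp), reflect_one_X, one_mul, reversed]

theorem reversed_reversed (n : ℕ) (p : ℂ[X]) : reversed n (reversed n p) = p := by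
  ext i
  rw [coeff_reversed, coeff_reversed, revAt_invol, Complex.conj_conj]

theorem reversed_succ {n : ℕ} {p : ℂ[X]} (hp : p.natDegree ≤ n) :
    reversed (n + 1) p = X * reversed n p := by
  rw [← reversed_reversed n p, reversed_reversed n (reversed n p),
    ← reversed_succ_X_mul (natDegree_reversed_le hp), reversed_reversed]

variable (μ : Measure Circle)

/-- On the circle both integrands equal z^n conj(p) conj(q). -/
theorem ip_reversed_left {n : ℕ} {p q : ℂ[X]} (hp : p.natDegree ≤ n) (hq : q.natDegree ≤ n) :
    ip μ (reversed n p) q = ip μ (reversed n q) p := by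
  rw [ip, ip]
  congr 1
  ext z
  rw [eval_reversed hp, eval_reversed hq]
  ring

end Reversed

/-! ### Szegő polynomials, their recurrence and norms -/

section Rho

variable (μ : Measure Circle)

theorem rho_zero : rho μ 0 = 1 := by
  rw [rho]
  simp

theorem monic_natDegree_rho (n : ℕ) : (rho μ n).Monic ∧ (rho μ n).natDegree = n := by
  induction n using Nat.strong_induction_on with
  | _ n ih =>
    have h : (∑ k : Fin n, C (ip μ (X ^ n) (rho μ k) / ip μ (rho μ k) (rho μ k)) *
        rho μ k).degree < (n : ℕ) := by
      rw [← mem_degreeLT]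
      refine Submodule.sum_mem _ fun k _ => ?_
      rw [C_mul']
      refine Submodule.smul_mem _ _ (mem_degreeLT.2 ?_)
      rw [degree_eq_natDegree (ih k k.2).1.ne_zero, (ih k k.2).2]
      exact_mod_cast k.2
    rw [rho]
    refine ⟨monic_X_pow_sub h, natDegree_eq_of_degree_eq_some ?_⟩
    rw [degree_sub_eq_left_of_degree_lt (by rwa [degree_X_pow]), degree_X_pow]

theorem rho_monic (n : ℕ) : (rho μ n).Monic := (monic_natDegree_rho μ n).1

theorem natDegree_rho (n : ℕ) : (rho μ n).natDegree = n := (monic_natDegree_rho μ n).2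

theorem degree_rho (n : ℕ) : (rho μ n).degree = n := by
  rw [degree_eq_natDegree (rho_monic μ n).ne_zero, natDegree_rho]

/-- The Szegő polynomials of degree less than `m` span the polynomials of degree less than `m`. -/
theorem degreeLT_le_of_rho_mem {S : Submodule ℂ ℂ[X]} {m : ℕ} (h : ∀ k < m, rho μ k ∈ S) :
    degreeLT ℂ m ≤ S := by
  induction m with
  | zero => 
    intro q hq
    have : q = 0 := by simpa [mem_degreeLT] using hq
    rw [this]
    exact S.zero_mem
  | succ m ih =>
    intro q hq
    have hq' : q - q.coeff m • rho μ m ∈ degreeLT ℂ m := by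
      rw [mem_degreeLT, degree_lt_iff_coeff_zero]
      intro i hi
      rw [coeff_sub, coeff_smul, smul_eq_mul]
      rcases hi.lt_or_eq with hi | rfl
      · rw [mem_degreeLT, degree_lt_iff_coeff_zero] at hq
        rw [hq i hi, coeff_eq_zero_of_natDegree_lt (p := rho μ m) (by rwa [natDegree_rho]), mul_zero,
          sub_zero]
      · have := (rho_monic μ m).coeff_natDegree
        rw [natDegree_rho] at this
        rw [this, mul_one, sub_self]
    rw [← sub_add_cancel q (q.coeff m • rho μ m)]
    exact S.add_mem (ih (fun k hk => h k (hk.trans m.lt_succ_self)) hq')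
      (S.smul_mem _ (h m m.lt_succ_self))

variable {μ}

theorem ip_rho_self_ne_zero [IsProbabilityMeasure μ] (hμ : μ.support.Infinite)
    (n : ℕ) : ip μ (rho μ n) (rho μ n) ≠ 0 :=
  ip_self_ne_zero hμ (rho_monic μ n).ne_zero

theorem ip_rho_rho_of_lt [IsProbabilityMeasure μ] (hμ : μ.support.Infinite)
    {n m : ℕ} (h : m < n) : ip μ (rho μ n) (rho μ m) = 0 := by
  induction n using Nat.strong_induction_on generalizing m with
  | _ n ih =>
    rw [rho, ip_sub_left, ip_sum_left, Finset.sum_eq_single (⟨m, h⟩ : Fin n)]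
    · rw [ip_C_mul_left, div_mul_cancel₀ _ (ip_rho_self_ne_zero hμ m), sub_self]
    · intro k _ hk
      rw [ip_C_mul_left]
      have hk' : (k : ℕ) ≠ m := fun h' => hk (Fin.ext h')
      rcases hk'.lt_or_gt with hlt | hlt
      · rw [(ip_eq_zero_comm μ).1 (ih m h hlt), mul_zero]
      · rw [ih k k.2 hlt, mul_zero]
    · simp

theorem ip_rho_right [IsProbabilityMeasure μ] (hμ : μ.support.Infinite)
    {n : ℕ} {q : ℂ[X]} (hq : q.degree < n) : ip μ q (rho μ n) = 0 :=
  degreeLT_le_of_rho_mem μ (S := LinearMap.ker (ipLin μ (rho μ n)))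
    (fun _ hk => (ip_eq_zero_comm μ).1 (ip_rho_rho_of_lt hμ hk)) (mem_degreeLT.2 hq)

theorem ip_rho_left [IsProbabilityMeasure μ] (hμ : μ.support.Infinite)
    {n : ℕ} {q : ℂ[X]} (hq : q.degree < n) : ip μ (rho μ n) q = 0 :=
  (ip_eq_zero_comm μ).1 (ip_rho_right hμ hq)

theorem ip_rho_self (n : ℕ) : ip μ (rho μ n) (rho μ n) = (e μ n : ℂ) := by
  rw [e, ip_self, Complex.ofReal_re]

theorem e_pos [IsProbabilityMeasure μ] (hμ : μ.support.Infinite) (n : ℕ) : 0 < e μ n := by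
  rw [e, ip_self, Complex.ofReal_re]
  exact integral_norm_sq_pos hμ (rho_monic μ n).ne_zero

theorem e_zero [IsProbabilityMeasure μ] : e μ 0 = 1 := by
  rw [e, rho_zero, ip]
  simp

/-- Reversal moves from ρ_n to `q`, and a vanishing constant term makes the reversed `q` of degree
below `n`. So ρ*_n is orthogonal to z, …, z^n. -/
theorem ip_reversed_rho [IsProbabilityMeasure μ] (hμ : μ.support.Infinite)
    {n : ℕ} {q : ℂ[X]} (hq : q.natDegree ≤ n) (h0 : q.coeff 0 = 0) :
    ip μ (reversed n (rho μ n)) q = 0 := by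
  rw [ip_reversed_left μ (natDegree_rho μ n).le hq]
  exact ip_rho_right hμ (degree_reversed_lt hq h0)

theorem coeff_zero_reversed_rho (n : ℕ) : (reversed n (rho μ n)).coeff 0 = 1 := by
  have := (rho_monic μ n).coeff_natDegree
  rw [natDegree_rho] at this
  rw [coeff_reversed, revAt_zero, this, map_one]

theorem ip_reversed_rho_self (n : ℕ) :
    ip μ (reversed n (rho μ n)) (reversed n (rho μ n)) = ip μ (rho μ n) (rho μ n) := by
  rw [ip_reversed_left μ (natDegree_rho μ n).le (natDegree_reversed_le (natDegree_rho μ n).le),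
    reversed_reversed]

/-- The Szegő recurrence. -/
theorem rho_succ [IsProbabilityMeasure μ] (hμ : μ.support.Infinite) (m : ℕ) :
    rho μ (m + 1) = X * rho μ m + C (schur μ (m + 1)) * reversed m (rho μ m) := by
  rw [← sub_eq_zero]
  -- `D` lies in the span of z, …, z^m, to which each of its three terms is orthogonal; hence ⟨D, D⟩
  -- = 0.
  set D := rho μ (m + 1) - (X * rho μ m + C (schur μ (m + 1)) * reversed m (rho μ m)) with hD
  have h0 : D.coeff 0 = 0 := by
    rw [hD, coeff_sub, coeff_add, coeff_C_mul, coeff_zero_reversed_rho, schur,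
      ← coeff_zero_eq_eval_zero]
    simp
  have hdeg : D.natDegree ≤ m := by
    have h1 : D = (rho μ (m + 1) - X * rho μ m) - C (schur μ (m + 1)) * reversed m (rho μ m) := by
      rw [hD]; ring
    have h2 : (rho μ (m + 1) - X * rho μ m).degree < ((m + 1 : ℕ) : WithBot ℕ) := by
      rw [← degree_rho μ (m + 1)]
      refine degree_sub_lt_left ?_ (rho_monic μ _).ne_zero
        ((rho_monic μ _).leadingCoeff.trans (monic_X.mul (rho_monic μ _)).leadingCoeff.symm)
      rw [degree_rho, degree_mul, degree_X, degree_rho, Nat.cast_add, Nat.cast_one, add_comm]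
    rw [h1]
    refine (natDegree_sub_le _ _).trans (max_le ?_ ?_)
    · rw [degree_lt_iff_coeff_zero] at h2
      rw [natDegree_le_iff_coeff_eq_zero]
      exact fun i hi => h2 i hi
    · exact (natDegree_C_mul_le _ _).trans (natDegree_reversed_le (natDegree_rho μ m).le)
  by_contra hne
  refine ip_self_ne_zero hμ hne ?_
  obtain ⟨Q, hQ⟩ := X_dvd_iff.2 h0
  have hQdeg : Q.degree < m := by
    have hQ0 : Q ≠ 0 := by rintro rfl; exact hne (by rw [hQ, mul_zero])
    rw [hQ, natDegree_mul X_ne_zero hQ0, natDegree_X] at hdeg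
    rw [degree_eq_natDegree hQ0]
    exact_mod_cast (by omega : Q.natDegree < m)
  have hDdeg : D.degree < (m + 1 : ℕ) :=
    degree_le_natDegree.trans_lt (by exact_mod_cast Nat.lt_succ_of_le hdeg)
  conv_lhs => arg 2; rw [hD]
  rw [ip_sub_left, ip_add_left, ip_C_mul_left, ip_rho_left hμ hDdeg, ip_reversed_rho hμ hdeg h0,
    hQ, ip_X_mul, ip_rho_left hμ hQdeg]
  simp

/-- Pythagoras for zρ_m = ρ_{m+1} - δ_{m+1}ρ*_m: the two terms on the right are orthogonal, while
zρ_m and ρ*_m both have squared norm e_m. -/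
theorem e_succ [IsProbabilityMeasure μ] (hμ : μ.support.Infinite)
    (m : ℕ) : e μ (m + 1) = e μ m * (1 - ‖schur μ (m + 1)‖ ^ 2) := by
  have h1 : X * rho μ m = rho μ (m + 1) - C (schur μ (m + 1)) * reversed m (rho μ m) := by
    rw [rho_succ hμ]; ring
  have horth : ip μ (reversed m (rho μ m)) (rho μ (m + 1)) = 0 :=
    ip_rho_right hμ (degree_le_natDegree.trans_lt (by
      exact_mod_cast Nat.lt_succ_of_le (natDegree_reversed_le (natDegree_rho μ m).le)))
  have horth' := (ip_eq_zero_comm μ).1 horth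
  have h2 : ip μ (rho μ (m + 1)) (X * rho μ m) = e μ (m + 1) := by
    rw [← conj_ip, h1, ip_sub_left, ip_C_mul_left, horth, ip_rho_self]
    simp
  have h3 : ip μ (reversed m (rho μ m)) (X * rho μ m) = -conj (schur μ (m + 1)) * e μ m := by
    rw [← conj_ip, h1, ip_sub_left, ip_C_mul_left, horth', ip_reversed_rho_self, ip_rho_self]
    simp
  have h4 : ip μ (X * rho μ m) (X * rho μ m) = e μ m := by rw [ip_X_mul, ip_rho_self]
  nth_rw 1 [h1] at h4
  rw [ip_sub_left, ip_C_mul_left, h2, h3] at h4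
  have h5 := Complex.mul_conj' (schur μ (m + 1))
  have : (e μ (m + 1) : ℂ) = e μ m * (1 - (‖schur μ (m + 1)‖ : ℂ) ^ 2) := by
    linear_combination h4 - (e μ m : ℂ) * h5
  exact_mod_cast this

theorem one_sub_norm_schur_sq_pos [IsProbabilityMeasure μ] (hμ : μ.support.Infinite)
    (m : ℕ) : 0 < 1 - ‖schur μ (m + 1)‖ ^ 2 := by
  have h := e_pos hμ (m + 1)
  rw [e_succ hμ] at h
  exact (pos_iff_pos_of_mul_pos h).1 (e_pos hμ m)

theorem eta_schur_succ [IsProbabilityMeasure μ] (hμ : μ.support.Infinite)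
    (m : ℕ) : eta (schur μ) (m + 1) = √(e μ (m + 1) / e μ m) := by
  rw [eta, e_succ hμ, mul_div_cancel_left₀ _ (e_pos hμ m).ne']

theorem eta_schur_succ_pos [IsProbabilityMeasure μ] (hμ : μ.support.Infinite)
    (m : ℕ) : 0 < eta (schur μ) (m + 1) :=
  Real.sqrt_pos.2 (one_sub_norm_schur_sq_pos hμ m)

theorem prod_eta_schur [IsProbabilityMeasure μ] (hμ : μ.support.Infinite) {j i : ℕ} (hji : j ≤ i) :
    ∏ k ∈ Finset.Ioc j i, eta (schur μ) k = √(e μ i / e μ j) := by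
  induction i, hji using Nat.le_induction with
  | base => simp [div_self (e_pos hμ j).ne']
  | succ i hi ih =>
    rw [Finset.prod_Ioc_succ_top (by omega), ih, eta_schur_succ hμ,
      ← Real.sqrt_mul (div_pos (e_pos hμ i) (e_pos hμ j)).le]
    congr 1
    have := (e_pos hμ i).ne'
    have := (e_pos hμ j).ne'
    field_simp

/-- Eliminating zρ_m between the Szegő recurrence and its reversal gives ρ*_{m+1} = (1 -
|δ_{m+1}|²)ρ*_m + conj(δ_{m+1})ρ_{m+1}, and the first factor is e_{m+1}/e_m. -/
theorem reversed_rho_eq_sum [IsProbabilityMeasure μ] (hμ : μ.support.Infinite) (m : ℕ) :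
    reversed m (rho μ m) =
      ∑ j ∈ Finset.range (m + 1), C (conj (schur μ j) * (e μ m / e μ j : ℝ)) * rho μ j := by
  induction m with
  | zero =>
    have : reversed 0 (rho μ 0) = 1 := by
      rw [rho_zero, reversed, Polynomial.map_one, reflect_one, pow_zero]
    rw [this]
    simp [schur, rho_zero, e_zero]
  | succ m ih =>
    have hrev : reversed (m + 1) (rho μ (m + 1)) =
        reversed m (rho μ m) + C (conj (schur μ (m + 1))) * (X * rho μ m) := by
      rw [rho_succ hμ, reversed_add, reversed_C_mul, reversed_succ_X_mul (natDegree_rho μ m).le,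
        reversed_succ (natDegree_reversed_le (natDegree_rho μ m).le), reversed_reversed]
    have h1 : X * rho μ m = rho μ (m + 1) - C (schur μ (m + 1)) * reversed m (rho μ m) := by
      rw [rho_succ hμ]; ring
    have h2 : reversed (m + 1) (rho μ (m + 1)) =
        C ((1 - ‖schur μ (m + 1)‖ ^ 2 : ℝ) : ℂ) * reversed m (rho μ m) +
          C (conj (schur μ (m + 1))) * rho μ (m + 1) := by
      have h3 : ((1 - ‖schur μ (m + 1)‖ ^ 2 : ℝ) : ℂ) =
          1 - schur μ (m + 1) * conj (schur μ (m + 1)) := by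
        rw [Complex.mul_conj']; push_cast; rfl
      rw [hrev, h1, h3, C_sub, C_mul, C_1]
      ring
    rw [h2, ih, Finset.sum_range_succ _ (m + 1), Finset.mul_sum, div_self (e_pos hμ _).ne',
      Complex.ofReal_one, mul_one]
    congr 1
    refine Finset.sum_congr rfl fun j _ => ?_
    rw [← mul_assoc, ← C_mul, e_succ hμ]
    congr 2
    push_cast
    ring

end Rho

/-! ### The Hessenberg matrix of multiplication by z -/

section Hessenberg

variable {μ : Measure Circle} [IsProbabilityMeasure μ]

theorem phi_zero : phi μ 0 = 1 := by
  simp [phi, e_zero, rho_zero]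

theorem rho_eq_phi (hμ : μ.support.Infinite) (n : ℕ) : rho μ n = C (√(e μ n) : ℂ) * phi μ n := by
  rw [phi, ← mul_assoc, ← C_mul, ← Complex.ofReal_mul,
    mul_inv_cancel₀ (Real.sqrt_pos.2 (e_pos hμ n)).ne', Complex.ofReal_one, C_1, one_mul]

theorem ip_phi_phi (hμ : μ.support.Infinite) (i j : ℕ) :
    ip μ (phi μ i) (phi μ j) = if i = j then 1 else 0 := by
  rw [phi, phi, ip_C_mul_left, ip_C_mul_right]
  split_ifs with h
  · subst h
    have h1 : (√(e μ i))⁻¹ * ((√(e μ i))⁻¹ * e μ i) = 1 := by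
      have h2 := (Real.sqrt_pos.2 (e_pos hμ i)).ne'
      have h3 := Real.mul_self_sqrt (e_pos hμ i).le
      field_simp
      linarith
    rw [ip_rho_self, Complex.conj_ofReal]
    exact_mod_cast h1
  · rcases Nat.lt_or_gt_of_ne h with h | h
    · rw [(ip_eq_zero_comm μ).1 (ip_rho_rho_of_lt hμ h), mul_zero, mul_zero]
    · rw [ip_rho_rho_of_lt hμ h, mul_zero, mul_zero]

variable (μ) in
/-- The normalized reversed polynomials `φ*_n = ρ*_n / √e_n`. -/
def revPhi (n : ℕ) : ℂ[X] := C (((√(e μ n))⁻¹ : ℝ) : ℂ) * reversed n (rho μ n)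

theorem revPhi_eq_sum (hμ : μ.support.Infinite) (m : ℕ) :
    revPhi μ m =
      ∑ j ∈ Finset.range (m + 1), C (conj (schur μ j) * (√(e μ m / e μ j) : ℝ)) * phi μ j := by
  rw [revPhi, reversed_rho_eq_sum hμ, Finset.mul_sum]
  refine Finset.sum_congr rfl fun j _ => ?_
  rw [rho_eq_phi hμ j, ← mul_assoc, ← mul_assoc, ← C_mul, ← C_mul]
  congr 2
  have h : (√(e μ m))⁻¹ * (e μ m / e μ j) * √(e μ j) = √(e μ m / e μ j) := by
    have h2 := (Real.sqrt_pos.2 (e_pos hμ j)).ne'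
    have h2' := (Real.sqrt_pos.2 (e_pos hμ m)).ne'
    have h3 := Real.sq_sqrt (e_pos hμ j).le
    have h3' := Real.sq_sqrt (e_pos hμ m).le
    rw [Real.sqrt_div (e_pos hμ m).le]
    field_simp
    rw [h3, h3', mul_div_cancel_right₀ _ (e_pos hμ j).ne']
  rw [← h]
  push_cast
  ring

theorem X_mul_phi (hμ : μ.support.Infinite) (m : ℕ) :
    X * phi μ m =
      C (eta (schur μ) (m + 1) : ℂ) * phi μ (m + 1) - C (schur μ (m + 1)) * revPhi μ m := by
  have h : eta (schur μ) (m + 1) * (√(e μ (m + 1)))⁻¹ = (√(e μ m))⁻¹ := by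
    have h2 := (Real.sqrt_pos.2 (e_pos hμ (m + 1))).ne'
    rw [eta_schur_succ hμ, Real.sqrt_div (e_pos hμ (m + 1)).le]
    field_simp
  rw [phi, phi, revPhi, ← mul_assoc (C (eta (schur μ) (m + 1) : ℂ)), ← C_mul,
    ← Complex.ofReal_mul, h, rho_succ hμ m]
  ring

theorem hessenberg_schur_of_le (hμ : μ.support.Infinite) {i j : ℕ} (h : j ≤ i) :
    hessenberg (schur μ) i j =
      -(conj (schur μ j)) * schur μ (i + 1) * (√(e μ i / e μ j) : ℝ) := by
  rw [hessenberg, Matrix.of_apply, if_pos h, ← prod_eta_schur hμ h, Complex.ofReal_prod]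

theorem hessenberg_succ (δ : ℕ → ℂ) (i : ℕ) : hessenberg δ i (i + 1) = eta δ (i + 1) := by
  rw [hessenberg, Matrix.of_apply, if_neg (by omega), if_pos rfl]

theorem hessenberg_of_lt (δ : ℕ → ℂ) {i j : ℕ} (h : i + 1 < j) : hessenberg δ i j = 0 := by
  rw [hessenberg, Matrix.of_apply, if_neg (by omega), if_neg (by omega)]

/-- Multiplication by `z` in the Szegő basis is represented by the Hessenberg matrix. -/
theorem X_mul_phi_eq_sum (hμ : μ.support.Infinite) (i : ℕ) :
    X * phi μ i =
      ∑ j ∈ Finset.range (i + 2), C (hessenberg (schur μ) i j) * phi μ j := by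
  rw [Finset.sum_range_succ, hessenberg_succ, X_mul_phi hμ, revPhi_eq_sum hμ, Finset.mul_sum,
    sub_eq_neg_add, ← Finset.sum_neg_distrib]
  congr 1
  refine Finset.sum_congr rfl fun j hj => ?_
  rw [hessenberg_schur_of_le hμ (Nat.lt_succ_iff.1 (Finset.mem_range.1 hj)), ← mul_assoc,
    ← neg_mul, ← C_mul, ← C_neg]
  congr 2
  ring

end Hessenberg

/-! ### The truncated matrix and its unitarity -/

section Truncated

variable {μ : Measure Circle}

theorem eta_update_of_ne (δ : ℕ → ℂ) {n k : ℕ} (h : k ≠ n) (c : ℂ) :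
    eta (Function.update δ n c) k = eta δ k := by
  rw [eta, eta, Function.update_of_ne h]

theorem U_castSucc {n : ℕ} (u : Circle) {i : Fin n} (hi : (i : ℕ) + 1 < n) (j : Fin n) :
    U μ n u i j = hessenberg (schur μ) i j := by
  have hj := j.2
  rw [U, Matrix.submatrix_apply, hessenberg, hessenberg, Matrix.of_apply, Matrix.of_apply,
    Function.update_of_ne (by omega), Function.update_of_ne (by omega),
    eta_update_of_ne _ (by omega)]
  congr 2
  refine Finset.prod_congr rfl fun k hk => ?_
  rw [eta_update_of_ne _ (by have := (Finset.mem_Ioc.1 hk).2; omega)]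

/-- The product of the η_k stops at k = n - 1, so the value of η at the replaced parameter `u`,
which is 0, never enters. -/
theorem U_last [IsProbabilityMeasure μ] (hμ : μ.support.Infinite) {n : ℕ} (u : Circle) {i : Fin n}
    (hi : (i : ℕ) + 1 = n) (j : Fin n) :
    U μ n u i j = -(conj (schur μ j)) * (u : ℂ) * (√(e μ i / e μ j) : ℝ) := by
  have hji : (j : ℕ) ≤ i := by omega
  rw [U, Matrix.submatrix_apply, hessenberg, Matrix.of_apply, if_pos hji,
    Function.update_of_ne (by omega), hi, Function.update_self, ← prod_eta_schur hμ hji,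
    Complex.ofReal_prod]
  congr 1
  refine Finset.prod_congr rfl fun k hk => ?_
  rw [eta_update_of_ne _ (by have := (Finset.mem_Ioc.1 hk).2; omega)]

theorem U_apply [IsProbabilityMeasure μ] (hμ : μ.support.Infinite) {n : ℕ} (u : Circle)
    (i j : Fin n) :
    U μ n u i j =
      if (i : ℕ) + 1 = n then
        -(conj (schur μ j)) * (u : ℂ) * (√(e μ (n - 1) / e μ j) : ℝ)
      else if (j : ℕ) ≤ i then
        -(conj (schur μ j)) * schur μ (i + 1) * (√(e μ i / e μ j) : ℝ)
      else if (j : ℕ) = i + 1 then (eta (schur μ) (i + 1) : ℂ)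
      else 0 := by
  split_ifs with h1 h2 h3
  · rw [U_last hμ u h1, show n - 1 = i by omega]
  · rw [U_castSucc u (by omega), hessenberg_schur_of_le hμ h2]
  · rw [U_castSucc u (by omega), h3, hessenberg_succ]
  · rw [U_castSucc u (by omega), hessenberg_of_lt _ (by omega)]

theorem para_eq {n : ℕ} (u : Circle) {i : Fin n} (hi : (i : ℕ) + 1 = n) :
    C (((√(e μ i))⁻¹ : ℝ) : ℂ) * para μ n u = X * phi μ i + C (u : ℂ) * revPhi μ i := by
  rw [para, phi, revPhi, show n - 1 = i by omega]
  ring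

variable [IsProbabilityMeasure μ]

theorem sum_U_phi_of_lt (hμ : μ.support.Infinite) {n : ℕ} (u : Circle) {i : Fin n}
    (hi : (i : ℕ) + 1 < n) :
    ∑ j : Fin n, C (U μ n u i j) * phi μ j = X * phi μ i := by
  simp_rw [U_castSucc u hi]
  rw [Fin.sum_univ_eq_sum_range (fun j => C (hessenberg (schur μ) i j) * phi μ j),
    X_mul_phi_eq_sum hμ]
  refine (Finset.sum_subset (Finset.range_mono (by omega)) fun j _ hj => ?_).symm
  rw [hessenberg_of_lt _ (by have := Finset.mem_range.not.1 hj; omega), C_0, zero_mul]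

theorem sum_U_phi_last (hμ : μ.support.Infinite) {n : ℕ} (u : Circle) {i : Fin n}
    (hi : (i : ℕ) + 1 = n) :
    ∑ j : Fin n, C (U μ n u i j) * phi μ j = C (-(u : ℂ)) * revPhi μ i := by
  simp_rw [U_last hμ u hi]
  rw [Fin.sum_univ_eq_sum_range
    (fun j => C (-(conj (schur μ j)) * (u : ℂ) * (√(e μ i / e μ j) : ℝ)) * phi μ j),
    revPhi_eq_sum hμ, Finset.mul_sum, hi]
  refine Finset.sum_congr rfl fun j _ => ?_
  rw [← mul_assoc, ← C_mul]
  congr 2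
  ring

theorem sum_U_phi (hμ : μ.support.Infinite) {n : ℕ} (u : Circle) (i : Fin n) :
    ∑ j : Fin n, C (U μ n u i j) * phi μ j =
      X * phi μ i - if (i : ℕ) + 1 = n then C (((√(e μ i))⁻¹ : ℝ) : ℂ) * para μ n u else 0 := by
  split_ifs with hi
  · rw [sum_U_phi_last hμ u hi, para_eq u hi, C_neg]
    ring
  · rw [sum_U_phi_of_lt hμ u (by omega), sub_zero]

theorem ip_revPhi_self (hμ : μ.support.Infinite) (n : ℕ) :
    ip μ (revPhi μ n) (revPhi μ n) = 1 := by
  rw [revPhi, ip_C_mul_left, ip_C_mul_right, ip_reversed_rho_self, ← ip_C_mul_right,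
    ← ip_C_mul_left]
  exact (ip_phi_phi hμ n n).trans (if_pos rfl)

theorem ip_revPhi_X_mul_phi (hμ : μ.support.Infinite) {m k : ℕ} (h : k < m) :
    ip μ (revPhi μ m) (X * phi μ k) = 0 := by
  rw [revPhi, phi, mul_left_comm, ip_C_mul_left, ip_C_mul_right,
    ip_reversed_rho hμ _ (by simp), mul_zero, mul_zero]
  rw [natDegree_mul X_ne_zero (rho_monic μ k).ne_zero, natDegree_X, natDegree_rho]
  omega

/-- Since the φ_j are orthonormal, the entries of U U* are the inner products of the polynomials
whose coordinates are the rows: zφ_i for i < n - 1, and -uφ*_{n-1}. -/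
theorem U_mem_unitaryGroup (hμ : μ.support.Infinite) (n : ℕ) (u : Circle) :
    U μ n u ∈ Matrix.unitaryGroup (Fin n) ℂ := by
  rw [Matrix.mem_unitaryGroup_iff]
  ext i k
  have h : (U μ n u * star (U μ n u)) i k =
      ip μ (∑ j : Fin n, C (U μ n u i j) * phi μ j) (∑ j : Fin n, C (U μ n u k j) * phi μ j) := by
    rw [ip_sum_left, Matrix.mul_apply]
    refine Finset.sum_congr rfl fun j _ => ?_
    rw [ip_C_mul_left, ip_sum_right, Finset.sum_eq_single j]
    · rw [ip_C_mul_right, ip_phi_phi hμ, if_pos rfl, mul_one]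
      rfl
    · intro l _ hl
      rw [ip_C_mul_right, ip_phi_phi hμ, if_neg (fun h => hl (Fin.ext h.symm)), mul_zero]
    · simp
  rw [h, Matrix.one_apply]
  have hi := i.2
  have hk := k.2
  by_cases hil : (i : ℕ) + 1 = n <;> by_cases hkl : (k : ℕ) + 1 = n
  · obtain rfl : i = k := Fin.ext (by omega)
    rw [sum_U_phi_last hμ u hil, ip_C_mul_left, ip_C_mul_right, ip_revPhi_self hμ, if_pos rfl,
      map_neg]
    linear_combination circle_mul_conj u
  · rw [sum_U_phi_last hμ u hil, sum_U_phi_of_lt hμ u (by omega), ip_C_mul_left,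
      ip_revPhi_X_mul_phi hμ (by omega), mul_zero, if_neg (by rintro rfl; exact hkl hil)]
  · rw [sum_U_phi_last hμ u hkl, sum_U_phi_of_lt hμ u (by omega), ip_C_mul_right,
      (ip_eq_zero_comm μ).1 (ip_revPhi_X_mul_phi hμ (by omega)), mul_zero,
      if_neg (by rintro rfl; exact hil hkl)]
  · rw [sum_U_phi_of_lt hμ u (by omega), sum_U_phi_of_lt hμ u (by omega), ip_X_mul, ip_phi_phi hμ]
    simp only [Fin.ext_iff]

end Truncated

/-! ### Eigenvalues and eigenvectors of U_n -/

section Eigen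

/-- The vector of the values at `x` of the first `n` orthonormal Szegő polynomials. -/
def phiVec (μ : Measure Circle) (n : ℕ) (x : ℂ) : Fin n → ℂ := fun i => (phi μ i).eval x

variable {μ : Measure Circle} [IsProbabilityMeasure μ]

theorem U_mulVec_phiVec_apply (hμ : μ.support.Infinite) {n : ℕ} (u : Circle) (x : ℂ) (i : Fin n) :
    (U μ n u).mulVec (phiVec μ n x) i = x * phiVec μ n x i -
      if (i : ℕ) + 1 = n then (((√(e μ i))⁻¹ : ℝ) : ℂ) * (para μ n u).eval x else 0 := by
  have h := congrArg (eval x) (sum_U_phi hμ u i)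
  rw [eval_finsetSum, eval_sub, eval_mul, eval_X, apply_ite (eval x), eval_mul, eval_C,
    eval_zero] at h
  simp only [eval_mul, eval_C] at h
  exact h

theorem U_mulVec_phiVec_of_isRoot (hμ : μ.support.Infinite) {n : ℕ} (u : Circle) {x : ℂ}
    (hx : (para μ n u).IsRoot x) : (U μ n u).mulVec (phiVec μ n x) = x • phiVec μ n x := by
  ext i
  rw [U_mulVec_phiVec_apply hμ, hx.eq_zero]
  simp

/-- An eigenvector of `U_n` is determined by its first entry. -/
theorem eq_smul_phiVec (hμ : μ.support.Infinite) {n : ℕ} (hn : 0 < n) (u : Circle) {x : ℂ}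
    {v : Fin n → ℂ} (hv : (U μ n u).mulVec v = x • v) : v = v ⟨0, hn⟩ • phiVec μ n x := by
  -- As φ_0 = 1, the first entry of `d` is 0. All rows of the eigenvalue equation but the last hold
  -- for `phiVec` at any `x`, hence for `d`.
  set d : Fin n → ℂ := v - v ⟨0, hn⟩ • phiVec μ n x with hd
  suffices h : ∀ k (hk : k < n), d ⟨k, hk⟩ = 0 by
    rw [← sub_eq_zero]
    ext i
    exact h i i.2
  have hrow : ∀ i : Fin n, (i : ℕ) + 1 < n → (U μ n u).mulVec d i = x * d i := by
    intro i hi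
    rw [hd, Matrix.mulVec_sub, Matrix.mulVec_smul, hv, Pi.sub_apply, Pi.smul_apply, Pi.smul_apply,
      U_mulVec_phiVec_apply hμ, if_neg (by omega)]
    simp only [Pi.sub_apply, Pi.smul_apply, smul_eq_mul]
    ring
  intro k
  induction k using Nat.strong_induction_on with
  | _ k ih =>
    intro hk
    rcases k with _ | k
    · simp [hd, phiVec, phi_zero]
    -- With d_0, …, d_k already zero, row k reduces to η_{k+1} d_{k+1} = 0.
    · have h := hrow ⟨k, by omega⟩ hk
      rw [ih k k.lt_succ_self, mul_zero, Matrix.mulVec, dotProduct,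
        Finset.sum_eq_single (⟨k + 1, hk⟩ : Fin n), U_castSucc u hk, hessenberg_succ] at h
      · exact (mul_eq_zero.1 h).resolve_left
          (by exact_mod_cast (eta_schur_succ_pos hμ k).ne')
      · intro j _ hj
        have hj' : (j : ℕ) ≠ k + 1 := fun h' => hj (Fin.ext h')
        rcases hj'.lt_or_gt with hlt | hlt
        · rw [ih j hlt j.2, mul_zero]
        · rw [U_castSucc u hk, hessenberg_of_lt _ hlt, zero_mul]
      · simp

theorem isRoot_of_mulVec_eq (hμ : μ.support.Infinite) {n : ℕ} (hn : 0 < n) (u : Circle) {x : ℂ}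
    {v : Fin n → ℂ} (hv0 : v ≠ 0) (hv : (U μ n u).mulVec v = x • v) :
    (para μ n u).IsRoot x := by
  have h := eq_smul_phiVec hμ hn u hv
  have hc : v ⟨0, hn⟩ ≠ 0 := by
    intro h0
    rw [h0, zero_smul] at h
    exact hv0 h
  rw [h, Matrix.mulVec_smul, smul_comm] at hv
  have hv' := congrFun (smul_right_injective _ hc hv) ⟨n - 1, by omega⟩
  rw [U_mulVec_phiVec_apply hμ, if_pos (by simp only; omega), Pi.smul_apply, smul_eq_mul,
    sub_eq_self, mul_eq_zero] at hv'
  refine hv'.resolve_left ?_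
  exact_mod_cast (inv_pos.2 (Real.sqrt_pos.2 (e_pos hμ _))).ne'

theorem hasEigenvector_toEuclideanLin_iff {n : ℕ} {A : Matrix (Fin n) (Fin n) ℂ} {x : ℂ}
    {v : EuclideanSpace ℂ (Fin n)} :
    Module.End.HasEigenvector (Matrix.toEuclideanLin A) x v ↔
      A.mulVec v.ofLp = x • v.ofLp ∧ v.ofLp ≠ 0 := by
  rw [Module.End.hasEigenvector_iff, Module.End.mem_eigenspace_iff, Matrix.toLpLin_apply,
    ← (WithLp.ofLp_injective 2).eq_iff, ← (WithLp.ofLp_injective 2).ne_iff]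
  rfl

theorem phiVec_ne_zero {n : ℕ} (hn : 0 < n) (x : ℂ) : phiVec μ n x ≠ 0 := by
  intro h
  have := congrFun h ⟨0, hn⟩
  simp [phiVec, phi_zero] at this

theorem hasEigenvalue_U_iff (hμ : μ.support.Infinite) {n : ℕ} (hn : 0 < n) (u : Circle) (x : ℂ) :
    Module.End.HasEigenvalue (Matrix.toEuclideanLin (U μ n u)) x ↔ (para μ n u).IsRoot x := by
  constructor
  · intro h
    obtain ⟨v, hv⟩ := h.exists_hasEigenvector
    rw [hasEigenvector_toEuclideanLin_iff] at hv
    exact isRoot_of_mulVec_eq hμ hn u hv.2 hv.1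
  · intro h
    refine Module.End.hasEigenvalue_of_hasEigenvector (x := WithLp.toLp 2 (phiVec μ n x)) ?_
    rw [hasEigenvector_toEuclideanLin_iff]
    exact ⟨U_mulVec_phiVec_of_isRoot hμ u h, phiVec_ne_zero hn x⟩

/-- Used twice: v = w forces a unimodular eigenvalue, and distinct unimodular eigenvalues force
orthogonality. -/
theorem star_dotProduct_of_mem_unitaryGroup {n : ℕ} {A : Matrix (Fin n) (Fin n) ℂ}
    (hA : A ∈ Matrix.unitaryGroup (Fin n) ℂ) {x y : ℂ} {v w : Fin n → ℂ}
    (hv : A.mulVec v = x • v) (hw : A.mulVec w = y • w) :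
    conj x * y * (star v ⬝ᵥ w) = star v ⬝ᵥ w := by
  have h : star (A.mulVec v) ⬝ᵥ A.mulVec w = star v ⬝ᵥ w := by
    rw [Matrix.star_mulVec, ← Matrix.dotProduct_mulVec, Matrix.mulVec_mulVec,
      ← Matrix.star_eq_conjTranspose, Matrix.mem_unitaryGroup_iff'.1 hA, Matrix.one_mulVec]
  rw [hv, hw, star_smul, smul_dotProduct, dotProduct_smul] at h
  rwa [smul_smul] at h

theorem star_dotProduct_self {n : ℕ} (v : Fin n → ℂ) :
    star v ⬝ᵥ v = ((∑ i, ‖v i‖ ^ 2 : ℝ) : ℂ) := by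
  rw [dotProduct, Complex.ofReal_sum]
  refine Finset.sum_congr rfl fun i _ => ?_
  rw [Pi.star_apply, Complex.ofReal_pow]
  exact Complex.conj_mul' (v i)

theorem sum_norm_phiVec_sq_pos {n : ℕ} (hn : 0 < n) (x : ℂ) :
    0 < ∑ i, ‖phiVec μ n x i‖ ^ 2 := by
  refine Finset.sum_pos' (fun i _ => by positivity) ⟨⟨0, hn⟩, Finset.mem_univ _, ?_⟩
  simp [phiVec, phi_zero]

theorem norm_eq_one_of_isRoot_para (hμ : μ.support.Infinite) {n : ℕ} (hn : 0 < n) (u : Circle)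
    {x : ℂ} (hx : (para μ n u).IsRoot x) : ‖x‖ = 1 := by
  have hv := U_mulVec_phiVec_of_isRoot hμ u hx
  have h := star_dotProduct_of_mem_unitaryGroup (U_mem_unitaryGroup hμ n u) hv hv
  rw [star_dotProduct_self] at h
  have h1 : conj x * x = 1 :=
    (mul_eq_right₀ (by exact_mod_cast (sum_norm_phiVec_sq_pos (μ := μ) hn x).ne')).1 h
  rw [Complex.conj_mul'] at h1
  have h2 : ‖x‖ ^ 2 = 1 := by exact_mod_cast h1
  exact (pow_eq_one_iff_of_nonneg (norm_nonneg x) two_ne_zero).1 h2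

end Eigen

/-! ### Zeros of the para-orthogonal polynomial -/

section ParaOrthogonal

variable {μ : Measure Circle}

theorem monic_natDegree_para {n : ℕ} (hn : 0 < n) (u : Circle) :
    (para μ n u).Monic ∧ (para μ n u).natDegree = n := by
  have h1 : (X * rho μ (n - 1)).Monic := monic_X.mul (rho_monic μ _)
  have hd : (X * rho μ (n - 1)).degree = (n : WithBot ℕ) := by
    rw [degree_mul, degree_X, degree_rho]
    exact_mod_cast (by omega : 1 + (n - 1) = n)
  have h2 : (C (u : ℂ) * reversed (n - 1) (rho μ (n - 1))).degree < (n : WithBot ℕ) := by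
    refine degree_le_natDegree.trans_lt ?_
    have := (natDegree_C_mul_le (u : ℂ) (reversed (n - 1) (rho μ (n - 1)))).trans
      (natDegree_reversed_le (natDegree_rho μ (n - 1)).le)
    exact_mod_cast (by omega)
  refine ⟨h1.add_of_left (by rwa [hd]), natDegree_eq_of_degree_eq_some ?_⟩
  rw [para, degree_add_eq_left_of_degree_lt (by rwa [hd]), hd]

theorem isRoot_para_iff_of_injective {n : ℕ} (hn : 0 < n) (u : Circle) {z : Fin n → Circle}
    (hz : Function.Injective z) (hroot : ∀ j, (para μ n u).IsRoot (z j : ℂ)) (x : ℂ) :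
    (para μ n u).IsRoot x ↔ ∃ j, x = z j := by
  obtain ⟨hmonic, hdeg⟩ := monic_natDegree_para (μ := μ) hn u
  refine ⟨fun hx => ?_, fun ⟨j, hj⟩ => hj ▸ hroot j⟩
  have hsub : Finset.univ.image (fun j => (z j : ℂ)) ⊆ (para μ n u).roots.toFinset := by
    intro y hy
    obtain ⟨j, -, rfl⟩ := Finset.mem_image.1 hy
    rw [Multiset.mem_toFinset, mem_roots hmonic.ne_zero]
    exact hroot j
  have hcard : (para μ n u).roots.toFinset.card ≤
      (Finset.univ.image (fun j => (z j : ℂ))).card := by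
    rw [Finset.card_image_of_injective _ (fun i j h => hz (Circle.ext h)), Finset.card_univ,
      Fintype.card_fin]
    exact (Multiset.toFinset_card_le _).trans ((card_roots' _).trans hdeg.le)
  have hx' : x ∈ Finset.univ.image (fun j => (z j : ℂ)) := by
    rw [Finset.eq_of_subset_of_card_le hsub hcard, Multiset.mem_toFinset,
      mem_roots hmonic.ne_zero]
    exact hx
  obtain ⟨j, -, hj⟩ := Finset.mem_image.1 hx'
  exact ⟨j, hj.symm⟩

variable [IsProbabilityMeasure μ]

/-- `P_n(z, u)` is orthogonal to `z, z², …, z^(n-1)`. -/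
theorem ip_para_X_mul (hμ : μ.support.Infinite) {n : ℕ} (u : Circle) {q : ℂ[X]}
    (hq : q.natDegree + 1 < n) : ip μ (para μ n u) (X * q) = 0 := by
  rw [para, ip_add_left, ip_C_mul_left, ip_X_mul, ip_rho_left hμ, ip_reversed_rho hμ, mul_zero,
    add_zero]
  · refine natDegree_mul_le.trans ?_
    rw [natDegree_X]
    omega
  · simp
  · exact degree_le_natDegree.trans_lt (by exact_mod_cast (by omega : q.natDegree < n - 1))

/-- If P_n = (z - x)²Q, then ⟨P_n, zQ⟩ = 0 by degree. But |x| = 1 gives conj(z)(z - x) = -x conj(z -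
x) on the circle, so this inner product is -x‖(z - x)Q‖² ≠ 0. -/
theorem nodup_roots_para (hμ : μ.support.Infinite) {n : ℕ} (hn : 0 < n) (u : Circle) :
    (para μ n u).roots.Nodup := by
  obtain ⟨hmonic, hdeg⟩ := monic_natDegree_para (μ := μ) hn u
  rw [Multiset.nodup_iff_count_le_one]
  intro x
  rw [count_roots]
  by_contra! h
  have hroot : (para μ n u).IsRoot x :=
    (rootMultiplicity_pos hmonic.ne_zero).1 (by omega)
  have hx : x * conj x = 1 := by
    rw [Complex.mul_conj', norm_eq_one_of_isRoot_para hμ hn u hroot]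
    simp
  obtain ⟨Q, hQ⟩ := (le_rootMultiplicity_iff hmonic.ne_zero).1 (Nat.succ_le_of_lt h)
  have hQ0 : Q ≠ 0 := by
    rintro rfl
    exact hmonic.ne_zero (by rw [hQ, mul_zero])
  have hQdeg : Q.natDegree + 1 < n := by
    rw [hQ, natDegree_mul (pow_ne_zero _ (X_sub_C_ne_zero x)) hQ0, natDegree_pow,
      natDegree_X_sub_C] at hdeg
    omega
  have horth := ip_para_X_mul hμ u hQdeg
  have hself : ip μ (para μ n u) (X * Q) =
      -x * ip μ ((X - C x) * Q) ((X - C x) * Q) := by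
    rw [hQ, ip, ip, ← integral_const_mul]
    congr 1
    ext z
    simp only [eval_mul, eval_pow, eval_sub, eval_X, eval_C, map_mul, map_sub]
    linear_combination ((z : ℂ) - x) * eval (z : ℂ) Q * conj (eval (z : ℂ) Q) *
      (circle_mul_conj z - hx)
  rw [hself, mul_eq_zero, neg_eq_zero] at horth
  rcases horth with rfl | h'
  · simp at hx
  · exact ip_self_ne_zero hμ (mul_ne_zero (X_sub_C_ne_zero x) hQ0) h'

theorem exists_injective_isRoot_para (hμ : μ.support.Infinite) {n : ℕ} (hn : 0 < n) (u : Circle) :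
    ∃ z : Fin n → Circle, Function.Injective z ∧ ∀ j, (para μ n u).IsRoot (z j : ℂ) := by
  obtain ⟨hmonic, hdeg⟩ := monic_natDegree_para (μ := μ) hn u
  have hcard : (para μ n u).roots.toFinset.card = n := by
    rw [Multiset.toFinset_card_of_nodup (nodup_roots_para hμ hn u),
      IsAlgClosed.card_roots_eq_natDegree, hdeg]
  have hroot : ∀ x : (para μ n u).roots.toFinset, (para μ n u).IsRoot (x : ℂ) := fun x =>
    (mem_roots hmonic.ne_zero).1 (Multiset.mem_toFinset.1 x.2)
  let f := (Finset.equivFinOfCardEq hcard).symm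
  refine ⟨fun j => ⟨f j, mem_sphere_zero_iff_norm.2
    (norm_eq_one_of_isRoot_para hμ hn u (hroot (f j)))⟩, fun i j hij => ?_, fun j => hroot (f j)⟩
  exact f.injective (Subtype.ext (congrArg (fun x : Circle => (x : ℂ)) hij))

end ParaOrthogonal

/-! ### Exactness as a matrix identity, and the weights -/

section Quadrature

/-- The difference of the inner product of `μ` and of its discretization with nodes `z` and
weights `w`, as a linear map in the first argument. -/
def ipError (μ : Measure Circle) [IsProbabilityMeasure μ] {n : ℕ} (z : Fin n → Circle)
    (w : Fin n → ℝ) (q : ℂ[X]) : ℂ[X] →ₗ[ℂ] ℂ :=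
  ∑ j, ((w j : ℂ) * conj (q.eval (z j : ℂ))) • leval (z j : ℂ) - ipLin μ q

variable {μ : Measure Circle} {n : ℕ} {z : Fin n → Circle} {w : Fin n → ℝ}

theorem phi_mem_degreeLT {k : ℕ} (hk : k < n) : phi μ k ∈ degreeLT ℂ n := by
  rw [phi, C_mul']
  refine Submodule.smul_mem _ _ (mem_degreeLT.2 ?_)
  rw [degree_rho]
  exact_mod_cast hk

variable (μ) in
/-- The matrix of the values at the nodes of the orthonormal Szegő polynomials. -/
def nodeMatrix (z : Fin n → Circle) : Matrix (Fin n) (Fin n) ℂ :=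
  Matrix.of fun i j => phiVec μ n (z j : ℂ) i

theorem conjTranspose_nodeMatrix_mul_apply (j k : Fin n) :
    ((nodeMatrix μ z).conjTranspose * nodeMatrix μ z) j k =
      star (phiVec μ n (z j : ℂ)) ⬝ᵥ phiVec μ n (z k : ℂ) := rfl

variable [IsProbabilityMeasure μ]

theorem ipError_apply (p q : ℂ[X]) : ipError μ z w q p =
    ∑ j, (w j : ℂ) * (p.eval (z j : ℂ) * conj (q.eval (z j : ℂ))) - ip μ p q := by
  rw [ipError, LinearMap.sub_apply, LinearMap.sum_apply, ipLin_apply]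
  congr 1
  refine Finset.sum_congr rfl fun j _ => ?_
  rw [LinearMap.smul_apply, leval_apply, smul_eq_mul]
  ring

theorem ipError_eq_zero_comm {p q : ℂ[X]} (h : ipError μ z w q p = 0) :
    ipError μ z w p q = 0 := by
  rw [ipError_apply] at h ⊢
  have := congrArg conj h
  rw [map_sub, conj_ip, map_sum, map_zero] at this
  rw [← this]
  congr 1
  refine Finset.sum_congr rfl fun j _ => ?_
  simp only [map_mul, Complex.conj_ofReal, Complex.conj_conj]
  ring

/-- The error form is sesquilinear and Hermitian, so it suffices to test it on a spanning family.
The family stays general because both the monomials and the φ_k are needed. -/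
theorem ipError_eq_zero {g : ℕ → ℂ[X]}
    (hg : ∀ S : Submodule ℂ ℂ[X], (∀ k < n, g k ∈ S) → degreeLT ℂ n ≤ S)
    (h : ∀ i < n, ∀ k < n, ipError μ z w (g k) (g i) = 0) {p q : ℂ[X]}
    (hp : p ∈ degreeLT ℂ n) (hq : q ∈ degreeLT ℂ n) : ipError μ z w q p = 0 := by
  have h1 : ∀ k < n, ∀ r ∈ degreeLT ℂ n, ipError μ z w (g k) r = 0 := fun k hk r hr =>
    hg (LinearMap.ker (ipError μ z w (g k))) (fun i hi => h i hi k hk) hr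
  exact hg (LinearMap.ker (ipError μ z w q)) (fun k hk => ipError_eq_zero_comm (h1 k hk q hq)) hp

theorem degreeLT_le_of_X_pow_mem (S : Submodule ℂ ℂ[X]) (h : ∀ k < n, (X : ℂ[X]) ^ k ∈ S) :
    degreeLT ℂ n ≤ S := by
  rw [degreeLT_eq_span_X_pow, Submodule.span_le]
  intro p hp
  obtain ⟨k, hk, rfl⟩ := Finset.mem_image.1 (Finset.mem_coe.1 hp)
  exact h k (Finset.mem_range.1 hk)

theorem degreeLT_le_of_phi_mem (hμ : μ.support.Infinite) (S : Submodule ℂ ℂ[X])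
    (h : ∀ k < n, phi μ k ∈ S) : degreeLT ℂ n ≤ S :=
  degreeLT_le_of_rho_mem μ fun k hk => by
    rw [rho_eq_phi hμ, C_mul']
    exact S.smul_mem _ (h k hk)

theorem evalCircle_T (k : ℤ) (x : Circle) :
    evalCircle (LaurentPolynomial.T k) x = (x : ℂ) ^ k := by
  rw [evalCircle, LaurentPolynomial.eval₂_T, Circle.toUnits_apply, Units.val_zpow_eq_zpow_val,
    Units.val_mk0]

theorem evalCircle_add (L M : ℂ[T;T⁻¹]) (x : Circle) :
    evalCircle (L + M) x = evalCircle L x + evalCircle M x := map_add _ _ _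

theorem evalCircle_smul (c : ℂ) (L : ℂ[T;T⁻¹]) (x : Circle) :
    evalCircle (c • L) x = c * evalCircle L x := by
  rw [evalCircle, LaurentPolynomial.smul_eq_C_mul, map_mul, LaurentPolynomial.eval₂_C,
    RingHom.id_apply, evalCircle]

theorem continuous_evalCircle (L : ℂ[T;T⁻¹]) : Continuous (evalCircle L) := by
  induction L using LaurentPolynomial.induction_on' with
  | add p q hp hq =>
    exact (hp.add hq).congr fun x => (evalCircle_add p q x).symm
  | C_mul_T k a =>
    have h : Continuous fun x : Circle => a * (x : ℂ) ^ k :=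
      continuous_const.mul (continuous_subtype_val.zpow₀ k fun x => Or.inl (Circle.coe_ne_zero x))
    refine h.congr fun x => ?_
    rw [← LaurentPolynomial.smul_eq_C_mul, evalCircle_smul, evalCircle_T]

theorem eval_X_pow_mul_conj (a b : ℕ) (x : Circle) :
    (X ^ a : ℂ[X]).eval (x : ℂ) * conj ((X ^ b : ℂ[X]).eval (x : ℂ)) =
      evalCircle (LaurentPolynomial.T ((a : ℤ) - b)) x := by
  rw [evalCircle_T, zpow_sub₀ x.coe_ne_zero, zpow_natCast, zpow_natCast, eval_pow, eval_X,
    eval_pow, eval_X, map_pow, ← Circle.coe_inv_eq_conj, Circle.coe_inv, inv_pow, div_eq_mul_inv]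

theorem ipError_X_pow (a b : ℕ) : ipError μ z w (X ^ b) (X ^ a) =
    ∑ j, (w j : ℂ) * evalCircle (LaurentPolynomial.T ((a : ℤ) - b)) (z j) -
      ∫ x, evalCircle (LaurentPolynomial.T ((a : ℤ) - b)) x ∂μ := by
  rw [ipError_apply, ip]
  simp only [eval_X_pow_mul_conj]

/-- A quadrature formula is exact on `Λ_{-(n-1), n-1}` if and only if it reproduces the inner
product of polynomials of degree less than `n`. -/
theorem exact_iff_ipError :
    (∀ L ∈ laurentSpan (-((n : ℤ) - 1)) ((n : ℤ) - 1),
      ∑ j, (w j : ℂ) * evalCircle L (z j) = ∫ x, evalCircle L x ∂μ) ↔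
    ∀ p ∈ degreeLT ℂ n, ∀ q ∈ degreeLT ℂ n, ipError μ z w q p = 0 := by
  constructor
  · intro h p hp q hq
    refine ipError_eq_zero degreeLT_le_of_X_pow_mem (fun a ha b hb => ?_) hp hq
    rw [ipError_X_pow, sub_eq_zero]
    exact h _ (Submodule.subset_span ⟨_, ⟨by omega, by omega⟩, rfl⟩)
  · intro h L hL
    have hX : ∀ k < n, (X ^ k : ℂ[X]) ∈ degreeLT ℂ n := fun k hk => by
      rw [mem_degreeLT, degree_X_pow]
      exact_mod_cast hk
    induction hL using Submodule.span_induction with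
    | mem L hL =>
      obtain ⟨k, ⟨hk1, hk2⟩, rfl⟩ := hL
      -- On the circle z^k = z^a conj(z^b), with a and b the positive and negative parts of k, both
      -- below n.
      have := h (X ^ k.toNat) (hX _ (by omega)) (X ^ (-k).toNat) (hX _ (by omega))
      rwa [ipError_X_pow, sub_eq_zero, show (k.toNat : ℤ) - ((-k).toNat : ℤ) = k by omega] at this
    | zero => simp [evalCircle]
    | add L M _ _ hL hM =>
      simp only [evalCircle_add, mul_add, Finset.sum_add_distrib]
      rw [hL, hM, integral_add (integrable_of_continuous μ (continuous_evalCircle L))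
        (integrable_of_continuous μ (continuous_evalCircle M))]
    | smul c L _ hL =>
      simp only [evalCircle_smul, mul_left_comm _ c, ← Finset.mul_sum]
      rw [hL, integral_const_mul]

theorem exact_iff_matrix (hμ : μ.support.Infinite) :
    (∀ L ∈ laurentSpan (-((n : ℤ) - 1)) ((n : ℤ) - 1),
      ∑ j, (w j : ℂ) * evalCircle L (z j) = ∫ x, evalCircle L x ∂μ) ↔
    nodeMatrix μ z * (Matrix.diagonal (fun j => (w j : ℂ)) * (nodeMatrix μ z).conjTranspose) =
      1 := by
  have key : ∀ i k : Fin n, ipError μ z w (phi μ k) (phi μ i) =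
      (nodeMatrix μ z * (Matrix.diagonal (fun j => (w j : ℂ)) *
        (nodeMatrix μ z).conjTranspose)) i k - (1 : Matrix (Fin n) (Fin n) ℂ) i k := by
    intro i k
    rw [ipError_apply, ip_phi_phi hμ, Matrix.mul_apply, Matrix.one_apply]
    simp only [Fin.ext_iff, Matrix.diagonal_mul, Matrix.conjTranspose_apply]
    congr 1
    exact Finset.sum_congr rfl fun j _ => mul_left_comm _ _ _
  rw [exact_iff_ipError]
  constructor
  · intro h
    ext i k
    rw [← sub_eq_zero, ← key]
    exact h _ (phi_mem_degreeLT i.2) _ (phi_mem_degreeLT k.2)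
  · intro h p hp q hq
    refine ipError_eq_zero (degreeLT_le_of_phi_mem hμ) (fun i hi k hk => ?_) hp hq
    rw [key ⟨i, hi⟩ ⟨k, hk⟩, h, sub_self]

/-- The weights of a Szegő quadrature formula are the values of the Christoffel function. -/
theorem weight_mul_sum_norm_phiVec_sq (hμ : μ.support.Infinite) {u : Circle}
    (h : IsSzegoQuadrature μ n u z w) (j : Fin n) :
    w j * ∑ i, ‖phiVec μ n (z j : ℂ) i‖ ^ 2 = 1 := by
  -- A one-sided inverse of a square matrix is two-sided; the (j, j) entry of D V* V = 1 is then the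
  -- claim.
  have h1 := mul_eq_one_comm.1 ((exact_iff_matrix hμ).1 h.exact)
  have h2 := congrFun (congrFun h1 j) j
  rw [Matrix.mul_assoc, Matrix.diagonal_mul, conjTranspose_nodeMatrix_mul_apply,
    star_dotProduct_self, Matrix.one_apply_eq] at h2
  exact_mod_cast h2

/-- The weights are the only possible ones, 1/‖Φ(z_j)‖². Exactness is D V* V = 1, whose off-diagonal
entries vanish because eigenvectors of a unitary matrix for distinct eigenvalues are orthogonal. -/
theorem exists_isSzegoQuadrature (hμ : μ.support.Infinite) (hn : 0 < n) (u : Circle) :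
    ∃ (z : Fin n → Circle) (w : Fin n → ℝ), IsSzegoQuadrature μ n u z w ∧ ∀ j, 0 < w j := by
  obtain ⟨z, hz, hroot⟩ := exists_injective_isRoot_para hμ hn u
  have hpos := fun j => sum_norm_phiVec_sq_pos (μ := μ) hn (z j : ℂ)
  refine ⟨z, fun j => (∑ i, ‖phiVec μ n (z j : ℂ) i‖ ^ 2)⁻¹, ⟨hz, hroot, ?_⟩,
    fun j => inv_pos.2 (hpos j)⟩
  rw [exact_iff_matrix hμ, mul_eq_one_comm]
  ext j k
  rw [Matrix.mul_assoc, Matrix.diagonal_mul, conjTranspose_nodeMatrix_mul_apply]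
  by_cases hjk : j = k
  · subst hjk
    rw [star_dotProduct_self, Matrix.one_apply_eq, ← Complex.ofReal_mul,
      inv_mul_cancel₀ (hpos j).ne', Complex.ofReal_one]
  · have h := star_dotProduct_of_mem_unitaryGroup (U_mem_unitaryGroup hμ n u)
      (U_mulVec_phiVec_of_isRoot hμ u (hroot j)) (U_mulVec_phiVec_of_isRoot hμ u (hroot k))
    rw [Matrix.one_apply_ne hjk]
    by_contra hne
    have h1 := (mul_eq_right₀ (right_ne_zero_of_mul hne)).1 h
    rw [← Circle.coe_inv_eq_conj, ← Circle.coe_mul, ← Circle.coe_one, Circle.coe_inj,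
      inv_mul_eq_one] at h1
    exact hjk (hz h1)

theorem weight_eq_norm_sq (hμ : μ.support.Infinite) (hn : 0 < n) {u : Circle}
    (h : IsSzegoQuadrature μ n u z w) (j : Fin n) {v : EuclideanSpace ℂ (Fin n)}
    (hv : Module.End.HasEigenvector (Matrix.toEuclideanLin (U μ n u)) (z j : ℂ) v)
    (hnorm : ‖v‖ = 1) : w j = ‖v ⟨0, hn⟩‖ ^ 2 := by
  have hv1 := eq_smul_phiVec hμ hn u (hasEigenvector_toEuclideanLin_iff.1 hv).1
  have h1 : ‖v ⟨0, hn⟩‖ ^ 2 * ∑ i, ‖phiVec μ n (z j : ℂ) i‖ ^ 2 = 1 := by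
    rw [← one_pow 2, ← hnorm, EuclideanSpace.norm_sq_eq, Finset.mul_sum]
    refine Finset.sum_congr rfl fun i _ => ?_
    conv_rhs => rw [hv1]
    rw [Pi.smul_apply, smul_eq_mul, norm_mul, mul_pow]
  exact mul_right_cancel₀ (sum_norm_phiVec_sq_pos hn (z j : ℂ)).ne'
    ((weight_mul_sum_norm_phiVec_sq hμ h j).trans h1.symm)

end Quadrature

end Szego

end

theorem theorem5p6 (μ : Measure Circle) [IsProbabilityMeasure μ] (hμ : μ.support.Infinite)
    (n : ℕ) (hn : 1 ≤ n) (u : Circle) :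
    -- `H(δ)` represents multiplication by `z` in the basis `φ_0, φ_1, …`
    (∀ i : ℕ, X * Szego.phi μ i =
      ∑ j ∈ Finset.range (i + 2),
        C (Szego.hessenberg (Szego.schur μ) i j) * Szego.phi μ j) ∧
    -- the entries of `U_n` (rows and columns numbered from `0`), and its unitarity
    (∀ i j : Fin n, Szego.U μ n u i j =
      if (i : ℕ) + 1 = n then
        -(conj (Szego.schur μ j)) * (u : ℂ) * (√(Szego.e μ (n - 1) / Szego.e μ j) : ℝ)
      else if (j : ℕ) ≤ i then
        -(conj (Szego.schur μ j)) * Szego.schur μ (i + 1) * (√(Szego.e μ i / Szego.e μ j) : ℝ)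
      else if (j : ℕ) = i + 1 then (Szego.eta (Szego.schur μ) (i + 1) : ℂ)
      else 0) ∧
    Szego.U μ n u ∈ Matrix.unitaryGroup (Fin n) ℂ ∧
    -- the Szegő quadrature formula with parameter `u` exists and has positive weights
    (∃ (z : Fin n → Circle) (w : Fin n → ℝ),
      Szego.IsSzegoQuadrature μ n u z w ∧ ∀ j, 0 < w j) ∧
    -- its nodes and weights
    (∀ (z : Fin n → Circle) (w : Fin n → ℝ), Szego.IsSzegoQuadrature μ n u z w →
      (∀ x : ℂ, Module.End.HasEigenvalue (Matrix.toEuclideanLin (Szego.U μ n u)) x ↔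
        ∃ j, x = z j) ∧
      (∀ x : ℂ, (Szego.para μ n u).IsRoot x ↔ ∃ j, x = z j) ∧
      (∀ (j : Fin n) (v : EuclideanSpace ℂ (Fin n)),
        Module.End.HasEigenvector (Matrix.toEuclideanLin (Szego.U μ n u)) (z j : ℂ) v →
        ‖v‖ = 1 → w j = ‖v ⟨0, hn⟩‖ ^ 2)) := by
  refine ⟨Szego.X_mul_phi_eq_sum hμ, Szego.U_apply hμ u, Szego.U_mem_unitaryGroup hμ n u,
    Szego.exists_isSzegoQuadrature hμ hn u, fun z w h => ?_⟩
  have hroot := Szego.isRoot_para_iff_of_injective hn u h.distinct h.isRoot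
  exact ⟨fun x => (Szego.hasEigenvalue_U_iff hμ hn u x).trans (hroot x), hroot,
    fun j v hv hnorm => Szego.weight_eq_norm_sq hμ hn h j hv hnorm⟩
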